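/- Let $L:\mathbb{R}^p\to\mathbb{R}$ be a loss function that is $C^2$ near $\theta^*$, with Hessian matrix $H(\theta^*)$, and let $\overline H_k$ ($k\ge 0$) be random symmetric $p\times p$ matrices (the Hessian estimates) that are strongly consistent: $\overline H_k\to H(\theta^*)$ almost surely. Each $\overline H_k$ is kept in a symmetric indefinite factorization $P_k\overline H_kP_k^T=L_kB_kL_k^T$, where $P_k$ is a permutation matrix, $L_k$ is unit lower triangular with entries bounded in magnitude by a fixed constant $M$, and $B_k$ is symmetric block diagonal with blocks of size $1\times1$ or $2\times2$. Let $B_k=Q_k\,\mathrm{diag}(\lambda_{k1},\dots,\lambda_{kp})\,Q_k^T$ with $Q_k$ orthogonal, fix a threshold $\underline\tau>0$, and let $$\overline\Lambda_k=\mathrm{diag}\big(\max\{\underline\tau,|\lambda_{k1}|\},\dots,\max\{\underline\tau,|\lambda_{kp}|\}\big),\qquad \overline{\overline H}_k=P_k^TL_kQ_k\overline\Lambda_kQ_k^TL_k^TP_k .$$ There are constants $0<\underline\sigma\le1\le\overline\sigma<\infty$, depending only on $p$ and $M$, such that every singular value of every unit lower triangular $p\times p$ matrix with entries bounded in magnitude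 by $M$ lies in $[\underline\sigma,\overline\sigma]$. Let $\underline\sigma>0$ and $\overline\sigma$ be any constants such that all singular values of all $L_k$ lie in $[\underline\sigma,\overline\sigma]$. **Theorem.** Assume that $0<\underline\lambda^*<|\lambda_j(H(\theta^*))|<\overline\lambda^*<\infty$ for all $j=1,\dots,p$, and put $\underline\lambda=\underline\lambda^*/2$ and $\overline\lambda=2\overline\lambda^*$. Then almost surely there is a (sample-path dependent) $K_2$ such that for all $k>K_2$: the eigenvalues of $\overline H_k$ satisfy $\underline\lambda<|\lambda_j(\overline H_k)|<\overline\lambda$ for all $j$; the matrix $\overline{\overline H}_k$ is positive definite, with $$\underline\sigma^2\max\Big\{\underline\tau,\frac{\underline\lambda}{\overline\sigma^2}\Big\}\le\lambda_j(\overline{\overline H}_k)\le\overline\sigma^2\max\Big\{\underline\tau,\frac{\overline\lambda}{\underline\sigma^2}\Big\}\qquad(j=1,\dots,p);$$ and its condition number satisfies $$\kappa(\overline{\overline H}_k)\le\frac{\overline\sigma^2}{\underline\sigma^2}\cdot\frac{\max\{\underline\tau,\ \overline\lambda/\underline\sigma^2\}}{\max\{\underline\tau,\ \underline\lambda/\overline\sigma^2\}}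 .$$ In particular, the bounds do not depend on $k$ or on the sample path. -/

import Mathlib

open MeasureTheory Filter Topology

noncomputable section

/-- `x` is a (real) eigenvalue of the square matrix `A`. -/
def IsEigenvalue {p : ℕ} (A : Matrix (Fin p) (Fin p) ℝ) (x : ℝ) : Prop :=
  Module.End.HasEigenvalue (Matrix.toLin' A) x

/-- The `i`-th singular value `σ_i(A)` (in decreasing order) of the square matrix `A`,
for the Euclidean inner product on `ℝ^p`. -/
def singularValue {p : ℕ} (A : Matrix (Fin p) (Fin p) ℝ) (i : Fin p) : ℝ :=
  (Matrix.toEuclideanLin A).singularValues i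

/-- The spectral norm `‖A‖₂`, i.e. the operator norm of `A` for the Euclidean norm. -/
def spectralNorm₂ {p : ℕ} (A : Matrix (Fin p) (Fin p) ℝ) : ℝ :=
  ‖Matrix.toEuclideanCLM (n := Fin p) (𝕜 := ℝ) A‖

/-- The condition number `κ(A) = ‖A‖₂ ‖A⁻¹‖₂` (meaningful for nonsingular `A`). -/
def conditionNumber {p : ℕ} (A : Matrix (Fin p) (Fin p) ℝ) : ℝ :=
  spectralNorm₂ A * spectralNorm₂ A⁻¹

/-- The Hessian matrix of `f : ℝ^p → ℝ` at `x`: the matrix of second partial derivatives. -/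
def hessianMatrix {p : ℕ} (f : EuclideanSpace ℝ (Fin p) → ℝ) (x : EuclideanSpace ℝ (Fin p)) :
    Matrix (Fin p) (Fin p) ℝ :=
  Matrix.of fun i j =>
    iteratedFDeriv ℝ 2 f x ![EuclideanSpace.single i 1, EuclideanSpace.single j 1]

/-- `A` is unit lower triangular and its entries have magnitude at most `M`. -/
structure IsBoundedUnitLower {p : ℕ} (M : ℝ) (A : Matrix (Fin p) (Fin p) ℝ) : Prop where
  lower : ∀ i j : Fin p, i < j → A i j = 0
  diag : ∀ i : Fin p, A i i = 1
  entries : ∀ i j : Fin p, |A i j| ≤ M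

/-- `B` is symmetric and block diagonal with diagonal blocks of size `1 × 1` or `2 × 2`:
it is tridiagonal, and no two consecutive off-diagonal entries are both nonzero. -/
structure IsSymmBlockDiagonal {p : ℕ} (B : Matrix (Fin p) (Fin p) ℝ) : Prop where
  symm : B.IsSymm
  tridiagonal : ∀ i j : Fin p, (i : ℕ) + 1 < (j : ℕ) → B i j = 0
  blocks : ∀ i j k : Fin p, (i : ℕ) + 1 = (j : ℕ) → (j : ℕ) + 1 = (k : ℕ) →
    B i j = 0 ∨ B j k = 0

/-- `P H Pᵀ = L B Lᵀ` is a symmetric indefinite factorization of `H`: `P` is a permutation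
matrix, `L` is unit lower triangular with entries bounded by `M`, and `B` is symmetric block
diagonal with blocks of size `1 × 1` or `2 × 2`. -/
structure IsSymmIndefFactorization {p : ℕ} (M : ℝ) (H P L B : Matrix (Fin p) (Fin p) ℝ) :
    Prop where
  perm : ∃ s : Equiv.Perm (Fin p), P = s.permMatrix ℝ
  unitLower : IsBoundedUnitLower M L
  blockDiagonal : IsSymmBlockDiagonal B
  factor : P * H * P.transpose = L * B * L.transpose

/-- `B = Q Λ Qᵀ` with `Q` orthogonal and `Λ = diag(lam)`. -/
structure IsEigenDecomposition {p : ℕ} (B Q : Matrix (Fin p) (Fin p) ℝ) (lam : Fin p → ℝ) :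
    Prop where
  orthogonal : Q ∈ Matrix.orthogonalGroup (Fin p) ℝ
  decomp : B = Q * Matrix.diagonal lam * Q.transpose

/-- The modified diagonal matrix `diag(max{τ, |lam 1|}, …, max{τ, |lam p|})`. -/
def modifiedDiagonal {p : ℕ} (τ : ℝ) (lam : Fin p → ℝ) : Matrix (Fin p) (Fin p) ℝ :=
  Matrix.diagonal fun j => max τ |lam j|

/-- The preconditioned Hessian estimate `Pᵀ L Q Λ̄ Qᵀ Lᵀ P`, where `Λ̄` is the modified diagonal
matrix with stability threshold `τ`. -/
def preconditionedHessian {p : ℕ} (τ : ℝ) (P L Q : Matrix (Fin p) (Fin p) ℝ)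
    (lam : Fin p → ℝ) : Matrix (Fin p) (Fin p) ℝ :=
  P.transpose * L * Q * modifiedDiagonal τ lam * Q.transpose * L.transpose * P

end

open scoped RealInnerProductSpace

/-! Everything is measured by two-sided bounds `a * ‖v‖ ≤ ‖A v‖ ≤ b * ‖v‖` (`NormBounds`), which
control singular values, eigenvalues of symmetric matrices and condition numbers alike, and pass
through products, inverses, transposes and small perturbations. With `S = Pᵀ L Q`, whose bounds are
those of `L`, the estimate is `S diag(lam) Sᵀ`. Hence `diag(lam) = S⁻¹ H S⁻ᵀ` inherits bounds from
`H`, the map `max τ |·|` preserves them, and multiplying back by `S` and `Sᵀ` bounds the modified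
matrix (`NormBounds.preconditionedHessian`). It is positive definite by congruence, so bounds on
`|x|` are bounds on the eigenvalue `x`. Convergence supplies bounds on `H` for large `k`;
compactness supplies those on `L`. -/

theorem isEigenvalue_eigenvalues {p : ℕ} {A : Matrix (Fin p) (Fin p) ℝ}
    (hs : (Matrix.toEuclideanLin A).IsSymmetric)
    (hn : Module.finrank ℝ (EuclideanSpace ℝ (Fin p)) = p) (i : Fin p) :
    IsEigenvalue A (hs.eigenvalues hn i) := by
  set e := hs.eigenvectorBasis hn
  refine Module.End.hasEigenvalue_of_hasEigenvector (x := WithLp.ofLp (e i)) ⟨?_, ?_⟩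
  · rw [Module.End.mem_eigenspace_iff]
    exact congrArg WithLp.ofLp (hs.apply_eigenvectorBasis hn i)
  · intro h0
    have : e i = 0 := by simpa using h0
    simpa [this] using e.norm_eq_one i

theorem Matrix.IsSymm.isSymmetric_toEuclideanLin {p : ℕ} {A : Matrix (Fin p) (Fin p) ℝ}
    (hA : A.IsSymm) : (Matrix.toEuclideanLin A).IsSymmetric :=
  Matrix.isSymmetric_toEuclideanLin_iff.mpr (by
    rw [Matrix.IsHermitian, Matrix.conjTranspose_eq_transpose_of_trivial]; exact hA)

/-- `A` distorts Euclidean norms by factors between `a` and `b`. -/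
structure NormBounds {p : ℕ} (a b : ℝ) (A : Matrix (Fin p) (Fin p) ℝ) : Prop where
  lower : ∀ v, a * ‖v‖ ≤ ‖Matrix.toEuclideanCLM (n := Fin p) (𝕜 := ℝ) A v‖
  upper : ∀ v, ‖Matrix.toEuclideanCLM (n := Fin p) (𝕜 := ℝ) A v‖ ≤ b * ‖v‖

/-! ### Calculus of two-sided norm bounds. -/

namespace NormBounds

variable {p : ℕ} {a b c d : ℝ} {A C : Matrix (Fin p) (Fin p) ℝ}

theorem mono (h : NormBounds a b A) (hc : c ≤ a) (hd : b ≤ d) : NormBounds c d A where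
  lower v := (mul_le_mul_of_nonneg_right hc (norm_nonneg v)).trans (h.lower v)
  upper v := (h.upper v).trans (mul_le_mul_of_nonneg_right hd (norm_nonneg v))

theorem mul (hA : NormBounds a b A) (hC : NormBounds c d C) (ha : 0 ≤ a) (hb : 0 ≤ b) :
    NormBounds (a * c) (b * d) (A * C) where
  lower v := by
    rw [map_mul, mul_apply_eq_comp, mul_assoc]
    exact (mul_le_mul_of_nonneg_left (hC.lower v) ha).trans (hA.lower _)
  upper v := by
    rw [map_mul, mul_apply_eq_comp, mul_assoc]
    exact (hA.upper _).trans (mul_le_mul_of_nonneg_left (hC.upper v) hb)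

theorem injective (h : NormBounds a b A) (ha : 0 < a) :
    Function.Injective (Matrix.toEuclideanCLM (n := Fin p) (𝕜 := ℝ) A) := by
  rw [injective_iff_map_eq_zero]
  intro v hv
  have := h.lower v
  rw [hv, norm_zero] at this
  exact norm_le_zero_iff.mp (by nlinarith [norm_nonneg v])

theorem injective_mulVec (h : NormBounds a b A) (ha : 0 < a) :
    Function.Injective A.mulVec := by
  intro x y hxy
  have := h.injective ha (a₁ := WithLp.toLp 2 x) (a₂ := WithLp.toLp 2 y) (by
    rw [Matrix.toEuclideanCLM_toLp, Matrix.toEuclideanCLM_toLp]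
    exact congrArg _ hxy)
  simpa using this

theorem isUnit (h : NormBounds a b A) (ha : 0 < a) : IsUnit A :=
  Matrix.mulVec_injective_iff_isUnit.mp (h.injective_mulVec ha)

theorem inv (h : NormBounds a b A) (ha : 0 < a) (hb : 0 < b) : NormBounds b⁻¹ a⁻¹ A⁻¹ := by
  have key (v) : Matrix.toEuclideanCLM (n := Fin p) (𝕜 := ℝ) A
      (Matrix.toEuclideanCLM (n := Fin p) (𝕜 := ℝ) A⁻¹ v) = v := by
    rw [← mul_apply_eq_comp, ← map_mul,
      Matrix.mul_nonsing_inv _ ((Matrix.isUnit_iff_isUnit_det A).mp (h.isUnit ha)), map_one,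
      one_apply_eq_self]
  constructor <;> intro v
  · have := h.upper (Matrix.toEuclideanCLM (n := Fin p) (𝕜 := ℝ) A⁻¹ v)
    rw [key] at this
    rwa [inv_mul_le_iff₀ hb]
  · have := h.lower (Matrix.toEuclideanCLM (n := Fin p) (𝕜 := ℝ) A⁻¹ v)
    rw [key] at this
    rwa [le_inv_mul_iff₀ ha]

theorem norm_le (h : NormBounds a b A) (hb : 0 ≤ b) : spectralNorm₂ A ≤ b :=
  ContinuousLinearMap.opNorm_le_bound _ hb h.upper

/-- Cauchy–Schwarz both ways: for `u = A w`, `‖u‖² = ⟪w, Aᵀ u⟫ ≤ ‖w‖ ‖Aᵀ u‖` with `a ‖w‖ ≤ ‖u‖`; for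
`u = Aᵀ v`, `‖u‖² = ⟪A u, v⟫ ≤ b ‖u‖ ‖v‖`. The lower bound makes `A` injective, hence surjective, so
every vector is some `A w`. -/
theorem transpose (h : NormBounds a b A) (ha : 0 < a) (hb : 0 ≤ b) :
    NormBounds a b A.transpose := by
  have hT (w v) : ⟪w, Matrix.toEuclideanCLM (n := Fin p) (𝕜 := ℝ) A.transpose v⟫ =
      ⟪Matrix.toEuclideanCLM (n := Fin p) (𝕜 := ℝ) A w, v⟫ := by
    rw [Matrix.inner_toEuclideanCLM, real_inner_comm, Matrix.inner_toEuclideanCLM,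
      Matrix.mulVec_transpose, dotProduct_comm, Matrix.dotProduct_mulVec]
  constructor <;> intro v
  · obtain ⟨w, rfl⟩ := LinearMap.surjective_of_injective
      (f := (Matrix.toEuclideanCLM (n := Fin p) (𝕜 := ℝ) A).toLinearMap) (h.injective ha) v
    simp only [ContinuousLinearMap.coe_coe]
    set u := Matrix.toEuclideanCLM (n := Fin p) (𝕜 := ℝ) A w with hu
    have h1 := hT w u
    rw [← hu, real_inner_self_eq_norm_sq] at h1
    have h2 := real_inner_le_norm w (Matrix.toEuclideanCLM (n := Fin p) (𝕜 := ℝ) A.transpose u)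
    rw [h1] at h2
    have h3 : a * ‖w‖ ≤ ‖u‖ := h.lower w
    set t := ‖Matrix.toEuclideanCLM (n := Fin p) (𝕜 := ℝ) A.transpose u‖
    have ht : 0 ≤ t := norm_nonneg _
    rcases (norm_nonneg u).eq_or_lt with h0 | h0
    · rw [← h0, mul_zero]; exact ht
    · refine le_of_mul_le_mul_right ?_ h0
      nlinarith [mul_le_mul_of_nonneg_right h3 ht]
  · set u := Matrix.toEuclideanCLM (n := Fin p) (𝕜 := ℝ) A.transpose v with hu
    have h1 := hT u v
    rw [← hu, real_inner_self_eq_norm_sq] at h1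
    have h2 := real_inner_le_norm (Matrix.toEuclideanCLM (n := Fin p) (𝕜 := ℝ) A u) v
    rw [← h1] at h2
    have h3 := mul_le_mul_of_nonneg_right (h.upper u) (norm_nonneg v)
    rcases (norm_nonneg u).eq_or_lt with h0 | h0
    · rw [← h0]; positivity
    · refine le_of_mul_le_mul_right ?_ h0
      nlinarith

theorem of_mem_orthogonalGroup (h : A ∈ Matrix.orthogonalGroup (Fin p) ℝ) :
    NormBounds 1 1 A := by
  have key (v) : ‖Matrix.toEuclideanCLM (n := Fin p) (𝕜 := ℝ) A v‖ = ‖v‖ := by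
    rw [← sq_eq_sq₀ (norm_nonneg _) (norm_nonneg _), ← real_inner_self_eq_norm_sq,
      ← real_inner_self_eq_norm_sq, Matrix.inner_toEuclideanCLM, Matrix.ofLp_toEuclideanCLM,
      Matrix.dotProduct_mulVec, ← Matrix.mulVec_transpose, Matrix.mulVec_mulVec,
      (Matrix.mem_orthogonalGroup_iff' _ _).mp h,
      Matrix.one_mulVec]
    rw [EuclideanSpace.inner_eq_star_dotProduct, star_trivial]
  exact ⟨fun v => by rw [key, one_mul], fun v => by rw [key, one_mul]⟩

theorem diagonal {f : Fin p → ℝ} (ha : 0 ≤ a) (hb : 0 ≤ b) (h : ∀ i, a ≤ |f i| ∧ |f i| ≤ b) :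
    NormBounds a b (Matrix.diagonal f) := by
  have key (v) : ‖Matrix.toEuclideanCLM (n := Fin p) (𝕜 := ℝ) (Matrix.diagonal f) v‖ ^ 2
      = ∑ i, (|f i| * |v i|) ^ 2 := by
    simp [EuclideanSpace.norm_sq_eq, Matrix.mulVec_diagonal, mul_pow]
  have key' (t : ℝ) (v : EuclideanSpace ℝ (Fin p)) : (t * ‖v‖) ^ 2 = ∑ i, (t * |v i|) ^ 2 := by
    simp [EuclideanSpace.norm_sq_eq, mul_pow, Finset.mul_sum]
  constructor <;> intro v
  · rw [← sq_le_sq₀ (by positivity) (by positivity), key, key']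
    gcongr
    exact (h _).1
  · rw [← sq_le_sq₀ (by positivity) (by positivity), key, key']
    gcongr
    exact (h _).2

/-- In an orthonormal eigenbasis of `T* T`, `‖T v‖²` is the sum of the squared coordinates of `v`
weighted by the squared singular values. -/
theorem of_singularValue (ha : 0 ≤ a) (hb : 0 ≤ b)
    (h : ∀ i, a ≤ singularValue A i ∧ singularValue A i ≤ b) : NormBounds a b A := by
  set T := Matrix.toEuclideanLin A
  have hn : Module.finrank ℝ (EuclideanSpace ℝ (Fin p)) = p := by simp
  set e := T.isSymmetric_adjoint_comp_self.eigenvectorBasis hn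
  have key (v) : ‖Matrix.toEuclideanCLM (n := Fin p) (𝕜 := ℝ) A v‖ ^ 2
      = ∑ i, (singularValue A i * ‖⟪e i, v⟫‖) ^ 2 := by
    change ‖T v‖ ^ 2 = _
    rw [← real_inner_self_eq_norm_sq, ← LinearMap.adjoint_inner_right,
      ← e.sum_inner_mul_inner]
    refine Finset.sum_congr rfl fun i _ => ?_
    change _ * ⟪e i, (LinearMap.adjoint T ∘ₗ T) v⟫ = _
    rw [← T.isSymmetric_adjoint_comp_self, LinearMap.IsSymmetric.apply_eigenvectorBasis,
      mul_pow, singularValue, LinearMap.sq_singularValues_fin _ hn, real_inner_comm,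
      real_inner_smul_left, Real.norm_eq_abs, sq_abs]
    simp only [RCLike.ofReal_real_eq_id, id]
    ring
  have key' (t : ℝ) (v : EuclideanSpace ℝ (Fin p)) :
      (t * ‖v‖) ^ 2 = ∑ i, (t * ‖⟪e i, v⟫‖) ^ 2 := by
    simp only [mul_pow, ← Finset.mul_sum, e.sum_sq_norm_inner_right]
  constructor <;> intro v
  · rw [← sq_le_sq₀ (by positivity) (by positivity), key, key']
    gcongr
    exact (h _).1
  · rw [← sq_le_sq₀ (by positivity) (by positivity), key, key']
    gcongr
    · exact mul_nonneg (ha.trans (h _).1) (norm_nonneg _)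
    · exact (h _).2

/-- The `i`-th unit eigenvector of `T* T` is stretched by exactly the `i`-th singular value. -/
theorem singularValue_mem (h : NormBounds a b A) (i : Fin p) :
    a ≤ singularValue A i ∧ singularValue A i ≤ b := by
  set T := Matrix.toEuclideanLin A
  have hn : Module.finrank ℝ (EuclideanSpace ℝ (Fin p)) = p := by simp
  set e := T.isSymmetric_adjoint_comp_self.eigenvectorBasis hn
  have hs : 0 ≤ singularValue A i := T.singularValues_nonneg _
  have key : ‖Matrix.toEuclideanCLM (n := Fin p) (𝕜 := ℝ) A (e i)‖ = singularValue A i := by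
    rw [← sq_eq_sq₀ (norm_nonneg _) hs]
    change ‖T (e i)‖ ^ 2 = _
    rw [← real_inner_self_eq_norm_sq, ← LinearMap.adjoint_inner_right]
    change ⟪e i, (LinearMap.adjoint T ∘ₗ T) (e i)⟫ = _
    rw [LinearMap.IsSymmetric.apply_eigenvectorBasis, real_inner_smul_right,
      real_inner_self_eq_norm_sq, e.norm_eq_one, singularValue,
      LinearMap.sq_singularValues_fin _ hn]
    simp
  have h1 := h.lower (e i)
  have h2 := h.upper (e i)
  rw [key, e.norm_eq_one, mul_one] at h1 h2
  exact ⟨h1, h2⟩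

theorem of_isSymm (hA : A.IsSymm) (ha : 0 ≤ a) (hb : 0 ≤ b)
    (h : ∀ x, IsEigenvalue A x → a ≤ |x| ∧ |x| ≤ b) : NormBounds a b A := by
  set T := Matrix.toEuclideanLin A
  have hn : Module.finrank ℝ (EuclideanSpace ℝ (Fin p)) = p := by simp
  have hs : T.IsSymmetric := hA.isSymmetric_toEuclideanLin
  set e := hs.eigenvectorBasis hn
  have heig (i) := isEigenvalue_eigenvalues hs hn i
  have key (v) : ‖Matrix.toEuclideanCLM (n := Fin p) (𝕜 := ℝ) A v‖ ^ 2
      = ∑ i, (|hs.eigenvalues hn i| * ‖⟪e i, v⟫‖) ^ 2 := by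
    change ‖T v‖ ^ 2 = _
    rw [← e.sum_sq_norm_inner_right]
    refine Finset.sum_congr rfl fun i _ => ?_
    rw [← hs, hs.apply_eigenvectorBasis, real_inner_smul_left, norm_mul]
    simp [e]
  have key' (t : ℝ) (v : EuclideanSpace ℝ (Fin p)) :
      (t * ‖v‖) ^ 2 = ∑ i, (t * ‖⟪e i, v⟫‖) ^ 2 := by
    simp only [mul_pow, ← Finset.mul_sum, e.sum_sq_norm_inner_right]
  constructor <;> intro v
  · rw [← sq_le_sq₀ (by positivity) (by positivity), key, key']
    gcongr
    exact (h _ (heig _)).1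
  · rw [← sq_le_sq₀ (by positivity) (by positivity), key, key']
    gcongr
    exact (h _ (heig _)).2

theorem abs_eigenvalue_mem (h : NormBounds a b A) {x : ℝ} (hx : IsEigenvalue A x) :
    a ≤ |x| ∧ |x| ≤ b := by
  obtain ⟨v, hv⟩ := Module.End.HasEigenvalue.exists_hasEigenvector hx
  have hpos : 0 < ‖WithLp.toLp 2 v‖ := by
    rw [norm_pos_iff]; simpa using hv.2
  have hAv : Matrix.toEuclideanCLM (n := Fin p) (𝕜 := ℝ) A (WithLp.toLp 2 v)
      = x • WithLp.toLp 2 v := by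
    rw [Matrix.toEuclideanCLM_toLp, ← Matrix.toLin'_apply, hv.apply_eq_smul, WithLp.toLp_smul]
  have h1 := h.lower (WithLp.toLp 2 v)
  have h2 := h.upper (WithLp.toLp 2 v)
  rw [hAv, norm_smul, Real.norm_eq_abs] at h1 h2
  exact ⟨le_of_mul_le_mul_right h1 hpos, le_of_mul_le_mul_right h2 hpos⟩

theorem of_diagonal {f : Fin p → ℝ} (h : NormBounds a b (Matrix.diagonal f)) (i : Fin p) :
    a ≤ |f i| ∧ |f i| ≤ b := by
  have h1 := h.lower (WithLp.toLp 2 (Pi.single i 1))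
  have h2 := h.upper (WithLp.toLp 2 (Pi.single i 1))
  rw [Matrix.toEuclideanCLM_toLp] at h1 h2
  simpa using And.intro h1 h2

theorem conditionNumber_le (h : NormBounds a b A) (ha : 0 < a) (hb : 0 < b) :
    conditionNumber A ≤ b / a := by
  rw [div_eq_mul_inv]
  exact mul_le_mul (h.norm_le hb.le) ((h.inv ha hb).norm_le (by positivity)) (norm_nonneg _) hb.le

theorem add (h : NormBounds a b A) {ε : ℝ}
    (hε : spectralNorm₂ (C - A) ≤ ε) : NormBounds (a - ε) (b + ε) C := by
  have key (v) : ‖Matrix.toEuclideanCLM (n := Fin p) (𝕜 := ℝ) C v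
      - Matrix.toEuclideanCLM (n := Fin p) (𝕜 := ℝ) A v‖ ≤ ε * ‖v‖ := by
    rw [← sub_apply, ← map_sub]
    exact ContinuousLinearMap.le_of_opNorm_le _ hε v
  constructor <;> intro v
  · have h1 := norm_sub_norm_le (Matrix.toEuclideanCLM (n := Fin p) (𝕜 := ℝ) A v)
      (Matrix.toEuclideanCLM (n := Fin p) (𝕜 := ℝ) C v)
    rw [norm_sub_rev] at h1
    linarith [h.lower v, key v]
  · have h1 := norm_sub_norm_le (Matrix.toEuclideanCLM (n := Fin p) (𝕜 := ℝ) C v)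
      (Matrix.toEuclideanCLM (n := Fin p) (𝕜 := ℝ) A v)
    linarith [h.upper v, key v]

end NormBounds

/-! ### Positivity, continuity and orthogonality. -/

theorem Matrix.PosDef.eigenvalue_pos {p : ℕ} {A : Matrix (Fin p) (Fin p) ℝ} (hA : A.PosDef)
    {x : ℝ} (hx : IsEigenvalue A x) : 0 < x := by
  obtain ⟨v, hv⟩ := Module.End.HasEigenvalue.exists_hasEigenvector hx
  have h := hA.dotProduct_mulVec_pos hv.2
  rw [← Matrix.toLin'_apply, hv.apply_eq_smul, dotProduct_smul, smul_eq_mul] at h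
  have h0 : 0 ≤ star v ⬝ᵥ v := dotProduct_star_self_nonneg v
  exact pos_of_mul_pos_left h h0

theorem continuous_toEuclideanCLM (p : ℕ) :
    Continuous fun A : Matrix (Fin p) (Fin p) ℝ =>
      Matrix.toEuclideanCLM (n := Fin p) (𝕜 := ℝ) A :=
  LinearMap.continuous_of_finiteDimensional
    (Matrix.toEuclideanCLM (n := Fin p) (𝕜 := ℝ)).toAlgEquiv.toLinearMap

theorem tendsto_spectralNorm_sub {ι : Type*} {l : Filter ι} {p : ℕ}
    {F : ι → Matrix (Fin p) (Fin p) ℝ} {A : Matrix (Fin p) (Fin p) ℝ}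
    (h : Tendsto F l (𝓝 A)) : Tendsto (fun i => spectralNorm₂ (F i - A)) l (𝓝 0) := by
  have := (((continuous_toEuclideanCLM p).norm.tendsto 0).comp (tendsto_sub_nhds_zero_iff.mpr h))
  simpa [spectralNorm₂, Function.comp_def] using this

theorem permMatrix_mem_orthogonalGroup {p : ℕ} (s : Equiv.Perm (Fin p)) :
    s.permMatrix ℝ ∈ Matrix.orthogonalGroup (Fin p) ℝ := by
  rw [Matrix.mem_orthogonalGroup_iff, 
   
    Matrix.transpose_permMatrix, ← Matrix.permMatrix_mul, inv_mul_cancel, Matrix.permMatrix_one]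

theorem transpose_mem_orthogonalGroup {p : ℕ} {A : Matrix (Fin p) (Fin p) ℝ}
    (h : A ∈ Matrix.orthogonalGroup (Fin p) ℝ) :
    A.transpose ∈ Matrix.orthogonalGroup (Fin p) ℝ := by
  rw [← Matrix.conjTranspose_eq_transpose_of_trivial, ← Matrix.star_eq_conjTranspose]
  exact Unitary.star_mem h

/-! ### Uniform bounds for unit lower triangular matrices. -/

theorem isCompact_setOf_isBoundedUnitLower (p : ℕ) (M : ℝ) :
    IsCompact {A : Matrix (Fin p) (Fin p) ℝ | IsBoundedUnitLower M A} := by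
  have hK : IsCompact (Set.pi Set.univ fun _ : Fin p => Set.pi Set.univ fun _ : Fin p =>
      Set.Icc (-M) M) := isCompact_univ_pi fun _ => isCompact_univ_pi fun _ => isCompact_Icc
  refine hK.of_isClosed_subset ?_ fun A hA i _ j _ => abs_le.mp (hA.entries i j)
  have : {A : Matrix (Fin p) (Fin p) ℝ | IsBoundedUnitLower M A} =
      {A | (∀ i j : Fin p, i < j → A i j = 0) ∧ (∀ i : Fin p, A i i = 1) ∧
        ∀ i j : Fin p, |A i j| ≤ M} :=
    Set.ext fun A => ⟨fun h => ⟨h.1, h.2, h.3⟩, fun h => ⟨h.1, h.2.1, h.2.2⟩⟩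
  rw [this]
  simp only [Set.ofPred_and, Set.ofPred_forall]
  have hc (i j : Fin p) : Continuous fun A : Matrix (Fin p) (Fin p) ℝ => A i j :=
    continuous_id.matrix_elem i j
  refine .inter ?_ (.inter ?_ ?_)
  · exact isClosed_iInter fun i => isClosed_iInter fun j => isClosed_iInter fun _ =>
      isClosed_eq (hc i j) continuous_const
  · exact isClosed_iInter fun i => isClosed_eq (hc i i) continuous_const
  · exact isClosed_iInter fun i => isClosed_iInter fun j =>
      isClosed_le (hc i j).abs continuous_const

theorem IsBoundedUnitLower.det_eq_one {p : ℕ} {M : ℝ} {A : Matrix (Fin p) (Fin p) ℝ}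
    (h : IsBoundedUnitLower M A) : A.det = 1 := by
  rw [Matrix.det_of_isLowerTriangular A fun i j hij => h.lower i j hij]
  simp [h.diag]

/-- `(A, v) ↦ ‖A v‖` is continuous on a compact set times the unit sphere, and positive there since
`det A = 1`; homogeneity extends its bounds to all `v`. -/
theorem exists_normBounds_of_isBoundedUnitLower (p : ℕ) (M : ℝ) :
    ∃ a b : ℝ, 0 < a ∧ a ≤ 1 ∧ 1 ≤ b ∧
      ∀ A : Matrix (Fin p) (Fin p) ℝ, IsBoundedUnitLower M A → NormBounds a b A := by
  have hK := (isCompact_setOf_isBoundedUnitLower p M).prod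
    (isCompact_sphere (0 : EuclideanSpace ℝ (Fin p)) 1)
  have hf : Continuous fun x : Matrix (Fin p) (Fin p) ℝ × EuclideanSpace ℝ (Fin p) =>
      ‖Matrix.toEuclideanCLM (n := Fin p) (𝕜 := ℝ) x.1 x.2‖ :=
    (((continuous_toEuclideanCLM p).comp continuous_fst).clm_apply continuous_snd).norm
  obtain ⟨a, ha, hlow⟩ := hK.exists_forall_le' hf.continuousOn (a := 0) (by
    rintro ⟨A, v⟩ ⟨hA, hv⟩
    have hA : IsBoundedUnitLower M A := hA
    rw [norm_pos_iff]
    intro h0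
    have hinj := Matrix.mulVec_injective_iff_isUnit.mpr
      ((Matrix.isUnit_iff_isUnit_det A).mpr (by rw [hA.det_eq_one]; exact isUnit_one))
    have h1 : A.mulVec (WithLp.ofLp v) = A.mulVec 0 := by
      rw [Matrix.mulVec_zero]; exact congrArg WithLp.ofLp h0
    have h2 : v = 0 := by simpa using hinj h1
    simp [h2] at hv)
  obtain ⟨b, hup⟩ := hK.bddAbove_image hf.continuousOn
  have hunit {v : EuclideanSpace ℝ (Fin p)} (hv : v ≠ 0) : ‖‖v‖⁻¹ • v‖ = 1 := by
    rw [norm_smul, norm_inv, norm_norm, inv_mul_cancel₀ (norm_ne_zero_iff.mpr hv)]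
  have hmem {A : Matrix (Fin p) (Fin p) ℝ} (hA : IsBoundedUnitLower M A)
      {v : EuclideanSpace ℝ (Fin p)} (hv : v ≠ 0) :
      (A, ‖v‖⁻¹ • v) ∈ {A : Matrix (Fin p) (Fin p) ℝ | IsBoundedUnitLower M A} ×ˢ
        Metric.sphere (0 : EuclideanSpace ℝ (Fin p)) 1 :=
    ⟨hA, by rw [mem_sphere_zero_iff_norm]; exact hunit hv⟩
  -- Truncating at 1 secures `a ≤ 1 ≤ b` even if the compact set is empty.
  refine ⟨min a 1, max b 1, lt_min ha one_pos, min_le_right _ _, le_max_right _ _, fun A hA => ?_⟩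
  suffices hab : NormBounds a b A from hab.mono (min_le_left _ _) (le_max_left _ _)
  constructor <;> intro v
  · rcases eq_or_ne v 0 with rfl | hv
    · simp
    have := hlow _ (hmem hA hv)
    simp only [map_smul, norm_smul, norm_inv, norm_norm] at this
    rwa [le_inv_mul_iff₀ (norm_pos_iff.mpr hv), mul_comm] at this
  · rcases eq_or_ne v 0 with rfl | hv
    · simp
    have := hup (Set.mem_image_of_mem _ (hmem hA hv))
    simp only [map_smul, norm_smul, norm_inv, norm_norm] at this
    rwa [inv_mul_le_iff₀ (norm_pos_iff.mpr hv), mul_comm] at this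

/-! ### The factorization and the modified matrix. -/

theorem IsSymmIndefFactorization.orthogonal {p : ℕ} {M : ℝ} {H P L B : Matrix (Fin p) (Fin p) ℝ}
    (h : IsSymmIndefFactorization M H P L B) : P ∈ Matrix.orthogonalGroup (Fin p) ℝ := by
  obtain ⟨s, rfl⟩ := h.perm
  exact permMatrix_mem_orthogonalGroup s

theorem IsSymmIndefFactorization.eq {p : ℕ} {M : ℝ} {H P L B : Matrix (Fin p) (Fin p) ℝ}
    (h : IsSymmIndefFactorization M H P L B) :
    H = P.transpose * L * B * (P.transpose * L).transpose := by
  have hP : P.transpose * P = 1 := (Matrix.mem_orthogonalGroup_iff' _ _).mp h.orthogonal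
  calc H = P.transpose * P * H * (P.transpose * P) := by rw [hP, one_mul, mul_one]
    _ = P.transpose * (P * H * P.transpose) * P := by simp only [mul_assoc]
    _ = _ := by
      rw [h.factor, Matrix.transpose_mul _ L, Matrix.transpose_transpose]
      simp only [mul_assoc]

theorem IsSymmIndefFactorization.isSymm {p : ℕ} {M : ℝ} {H P L B : Matrix (Fin p) (Fin p) ℝ}
    (h : IsSymmIndefFactorization M H P L B) : H.IsSymm := by
  rw [h.eq, Matrix.IsSymm, Matrix.transpose_mul, Matrix.transpose_transpose,
    Matrix.transpose_mul _ B, h.blockDiagonal.symm]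
  simp only [mul_assoc]

theorem preconditionedHessian_eq {p : ℕ} (τ : ℝ) (P L Q : Matrix (Fin p) (Fin p) ℝ)
    (lam : Fin p → ℝ) :
    preconditionedHessian τ P L Q lam =
      P.transpose * L * Q * modifiedDiagonal τ lam * (P.transpose * L * Q).transpose := by
  simp only [preconditionedHessian, Matrix.transpose_mul, Matrix.transpose_transpose, mul_assoc]

theorem preconditionedHessian_posDef {p : ℕ} {τ a b : ℝ} (hτ : 0 < τ)
    {P L Q : Matrix (Fin p) (Fin p) ℝ} (lam : Fin p → ℝ) (ha : 0 < a) (hb : 0 ≤ b)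
    (hS : NormBounds a b (P.transpose * L * Q)) :
    (preconditionedHessian τ P L Q lam).PosDef := by
  rw [preconditionedHessian_eq,
    ← Matrix.conjTranspose_eq_transpose_of_trivial (P.transpose * L * Q)]
  refine Matrix.PosDef.mul_mul_conjTranspose_same
    (Matrix.PosDef.diagonal fun i => lt_max_of_lt_left hτ) ?_
  -- Injectivity of `vecMul` by `S` is injectivity of `Sᵀ`.
  intro x y hxy
  refine (hS.transpose ha hb).injective_mulVec ha ?_
  simpa only [Matrix.mulVec_transpose] using hxy

/-- The deterministic core: undoing the congruence by `S` costs `t ^ 2` and `s ^ 2` in the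
denominators, redoing it after the modification costs `s ^ 2` and `t ^ 2` as factors. -/
theorem NormBounds.preconditionedHessian {p : ℕ} {M τ a b s t : ℝ} (hτ : 0 < τ)
    {H P L B Q : Matrix (Fin p) (Fin p) ℝ} {lam : Fin p → ℝ}
    (hfac : IsSymmIndefFactorization M H P L B) (heig : IsEigenDecomposition B Q lam)
    (hH : NormBounds a b H) (ha : 0 < a) (hb : 0 < b)
    (hS : NormBounds s t (P.transpose * L * Q)) (hs : 0 < s) (ht : 0 < t) :
    NormBounds (s ^ 2 * max τ (a / t ^ 2)) (t ^ 2 * max τ (b / s ^ 2))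
      (preconditionedHessian τ P L Q lam) := by
  have hSt := hS.transpose hs ht.le
  have hlam : NormBounds (a / t ^ 2) (b / s ^ 2) (Matrix.diagonal lam) := by
    have hfact : H = P.transpose * L * Q * Matrix.diagonal lam *
        (P.transpose * L * Q).transpose := by
      rw [hfac.eq, heig.decomp, Matrix.transpose_mul _ Q]
      simp only [mul_assoc]
    have hU := (Matrix.isUnit_iff_isUnit_det _).mp (hS.isUnit hs)
    have hUt := (Matrix.isUnit_iff_isUnit_det _).mp (hSt.isUnit hs)
    have heq : Matrix.diagonal lam =
        (P.transpose * L * Q)⁻¹ * H * ((P.transpose * L * Q).transpose)⁻¹ := by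
      rw [hfact, Matrix.mul_assoc _ (Matrix.diagonal lam), Matrix.nonsing_inv_mul_cancel_left _ _ hU,
        Matrix.mul_nonsing_inv_cancel_right _ _ hUt]
    rw [heq]
    refine (((hS.inv hs ht).mul hH (by positivity) (by positivity)).mul (hSt.inv hs ht)
      (by positivity) (by positivity)).mono (le_of_eq ?_) (le_of_eq ?_) <;> field_simp
  have hD : NormBounds (max τ (a / t ^ 2)) (max τ (b / s ^ 2)) (modifiedDiagonal τ lam) := by
    refine .diagonal (by positivity) (by positivity) fun i => ?_
    rw [abs_of_pos (lt_max_of_lt_left hτ)]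
    exact ⟨max_le_max_left _ (hlam.of_diagonal i).1, max_le_max_left _ (hlam.of_diagonal i).2⟩
  rw [preconditionedHessian_eq]
  refine ((hS.mul hD hs.le ht.le).mul hSt (by positivity) (by positivity)).mono
    (le_of_eq ?_) (le_of_eq ?_) <;> ring

theorem not_isEigenvalue_of_isEmpty {A : Matrix (Fin 0) (Fin 0) ℝ} {x : ℝ} :
    ¬ IsEigenvalue A x := fun h => by
  obtain ⟨v, hv⟩ := Module.End.HasEigenvalue.exists_hasEigenvector h
  exact hv.2 (Subsingleton.elim _ _)

/-! ### The main theorem. -/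

theorem theorem4
    -- dimension, entry bound of the triangular factors, stability threshold
    (p : ℕ) (M τ : ℝ) (hτ : 0 < τ)
    -- loss function, the point `θ*`, and the eigenvalue bounds for the Hessian there
    (loss : EuclideanSpace ℝ (Fin p) → ℝ) (θstar : EuclideanSpace ℝ (Fin p))
    (hloss : ContDiffAt ℝ 2 loss θstar)
    (lamLo lamHi : ℝ) (hlamLo : 0 < lamLo)
    (hlam : ∀ x : ℝ, IsEigenvalue (hessianMatrix loss θstar) x → lamLo < |x| ∧ |x| < lamHi)
    -- the random Hessian estimates, which are strongly consistent
    {Ω : Type*} [MeasurableSpace Ω] (μ : Measure Ω) [IsProbabilityMeasure μ]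
    (Hbar : ℕ → Ω → Matrix (Fin p) (Fin p) ℝ)
    (hconv : ∀ᵐ ω ∂μ, Tendsto (fun k => Hbar k ω) atTop (𝓝 (hessianMatrix loss θstar)))
    -- their symmetric indefinite factorizations, and eigen-decompositions of the middle factors
    (P L B Q : ℕ → Ω → Matrix (Fin p) (Fin p) ℝ) (lam : ℕ → Ω → Fin p → ℝ)
    (hfac : ∀ k ω, IsSymmIndefFactorization M (Hbar k ω) (P k ω) (L k ω) (B k ω))
    (heig : ∀ k ω, IsEigenDecomposition (B k ω) (Q k ω) (lam k ω)) :
    -- uniform bounds for the singular values that depend on `p` and `M` only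
    (∃ sLo sHi : ℝ, 0 < sLo ∧ sLo ≤ 1 ∧ 1 ≤ sHi ∧
      ∀ A : Matrix (Fin p) (Fin p) ℝ, IsBoundedUnitLower M A →
        ∀ i : Fin p, sLo ≤ singularValue A i ∧ singularValue A i ≤ sHi) ∧
    -- explicit uniform bounds, for any such bounds of the singular values of the factors
    (∀ sLo sHi : ℝ, 0 < sLo →
      (∀ k ω, ∀ i : Fin p, sLo ≤ singularValue (L k ω) i ∧ singularValue (L k ω) i ≤ sHi) →
      ∀ᵐ ω ∂μ, ∃ K₂ : ℕ, ∀ k : ℕ, K₂ < k →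
        (∀ x : ℝ, IsEigenvalue (Hbar k ω) x → lamLo / 2 < |x| ∧ |x| < 2 * lamHi) ∧
        (preconditionedHessian τ (P k ω) (L k ω) (Q k ω) (lam k ω)).PosDef ∧
        (∀ x : ℝ,
          IsEigenvalue (preconditionedHessian τ (P k ω) (L k ω) (Q k ω) (lam k ω)) x →
            sLo ^ 2 * max τ ((lamLo / 2) / sHi ^ 2) ≤ x ∧
            x ≤ sHi ^ 2 * max τ ((2 * lamHi) / sLo ^ 2)) ∧
        conditionNumber (preconditionedHessian τ (P k ω) (L k ω) (Q k ω) (lam k ω)) ≤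
          sHi ^ 2 / sLo ^ 2 *
            (max τ ((2 * lamHi) / sLo ^ 2) / max τ ((lamLo / 2) / sHi ^ 2))) := by
  constructor
  · obtain ⟨a, b, ha, ha1, hb1, h⟩ := exists_normBounds_of_isBoundedUnitLower p M
    exact ⟨a, b, ha, ha1, hb1, fun A hA i => (h A hA).singularValue_mem i⟩
  intro sLo sHi hsLo hs
  -- For `p = 0` the spectral hypotheses are vacuous and do not force `sHi` or `lamHi` to be
  -- positive.
  rcases p.eq_zero_or_pos with rfl | hp
  · refine ae_of_all _ fun ω => ⟨0, fun k _ => ⟨fun x hx => (not_isEigenvalue_of_isEmpty hx).elim,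
      ?_, fun x hx => (not_isEigenvalue_of_isEmpty hx).elim, ?_⟩⟩
    · exact Matrix.PosDef.of_dotProduct_mulVec_pos (Subsingleton.elim _ _)
        fun x hx => (hx (Subsingleton.elim _ _)).elim
    · have h0 : conditionNumber
          (preconditionedHessian τ (P k ω) (L k ω) (Q k ω) (lam k ω)) = 0 := by
        simp [conditionNumber, spectralNorm₂, Subsingleton.elim
          (preconditionedHessian τ (P k ω) (L k ω) (Q k ω) (lam k ω)) 0]
      rw [h0]
      positivity
  filter_upwards [hconv] with ω hω
  have hsHi : 0 < sHi := by
    have := hs 0 ω ⟨0, hp⟩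
    linarith
  -- Symmetry is a closed condition, so the limit inherits it from the factored estimates.
  have hsymm : (hessianMatrix loss θstar).IsSymm :=
    (isClosed_eq (continuous_id.matrix_transpose) continuous_id).mem_of_tendsto hω
      (.of_forall fun k => (hfac k ω).isSymm)
  have hlamHi : lamLo < lamHi := by
    have h := hlam _ (isEigenvalue_eigenvalues hsymm.isSymmetric_toEuclideanLin
      finrank_euclideanSpace_fin ⟨0, hp⟩)
    exact h.1.trans h.2
  have hH : NormBounds lamLo lamHi (hessianMatrix loss θstar) :=
    .of_isSymm hsymm hlamLo.le (hlamLo.trans hlamHi).le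
      fun x hx => ⟨(hlam x hx).1.le, (hlam x hx).2.le⟩
  -- An error of `lamLo / 4`, rather than `lamLo / 2`, keeps the final eigenvalue bounds strict.
  have hev := (tendsto_spectralNorm_sub hω).eventually_le_const (show (0 : ℝ) < lamLo / 4 by linarith)
  obtain ⟨K, hK⟩ := eventually_atTop.mp hev
  refine ⟨K, fun k hk => ?_⟩
  have hHk := hH.add (hK k hk.le)
  have hHk' : NormBounds (lamLo / 2) (2 * lamHi) (Hbar k ω) :=
    hHk.mono (by linarith) (by linarith)
  have hS : NormBounds sLo sHi ((P k ω).transpose * L k ω * Q k ω) := by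
    have hP := NormBounds.of_mem_orthogonalGroup
      (transpose_mem_orthogonalGroup (hfac k ω).orthogonal)
    have hL := NormBounds.of_singularValue hsLo.le hsHi.le (hs k ω)
    have hQ := NormBounds.of_mem_orthogonalGroup (heig k ω).orthogonal
    simpa using (hP.mul hL zero_le_one zero_le_one).mul hQ (by simpa using hsLo.le)
      (by simpa using hsHi.le)
  have hPD := preconditionedHessian_posDef hτ (lam k ω) hsLo hsHi.le hS
  have hb := hHk'.preconditionedHessian hτ (hfac k ω) (heig k ω) (by linarith) (by linarith)
    hS hsLo hsHi
  refine ⟨fun x hx => ?_, hPD, fun x hx => ?_, ?_⟩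
  · have := hHk.abs_eigenvalue_mem hx
    constructor <;> linarith
  · simpa only [abs_of_pos (hPD.eigenvalue_pos hx)] using hb.abs_eigenvalue_mem hx
  · rw [div_mul_div_comm]
    exact hb.conditionNumber_le (by positivity) (by positivity)
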